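/- All manifolds are smooth, finite-dimensional, Hausdorff and second-countable, and all maps are smooth. Let $\pi:Q\to\mathbb R$ be a fibre bundle over the time axis, $\dim Q=m+1$, with fibred coordinates $(t,q^i)$, $t=\pi$. Let $J^1Q$ be its first order jet manifold, with coordinates $(t,q^i,q^i_t)$, and let $V^*Q$ be the dual of the vertical tangent bundle $VQ=\operatorname{Ker}T\pi$, with coordinates $(t,q^i,p_i)$. Let $L=\mathcal L\,dt$, $\mathcal L\in C^\infty(J^1Q)$, be a Lagrangian, $\widehat L:J^1Q\to V^*Q$, $p_i\circ\widehat L=\partial\mathcal L/\partial q^i_t$, its Legendre map (over $Q$), and $N_L=\widehat L(J^1Q)$. Assume that $L$ is almost regular: $N_L$ is a closed imbedded subbundle (a closed imbedded submanifold which is a locally trivial fibre bundle over $Q$) of $V^*Q\to Q$, and $\widehat L:J^1Q\to N_L$ is a fibred manifold, i.e. a surjective submersion, with connected fibres. A Hamiltonian form $H=p_i\,dq^i-\mathcal H\,dt$ on $V^*Q$ is the pull-back of the Liouville form of $T^*Q$ by a global section, with $p_0=-\mathcal H$, of the canonical projection $\zeta:T^*Q\to V^*Q$. It defines the Hamiltonian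 map $\widehat H:V^*Q\to J^1Q$ over $Q$, $q^i_t\circ\widehat H=\partial\mathcal H/\partial p_i$, and the Lagrangian $L_H=(p_iq^i_t-\mathcal H)\,dt$ on $V^*Q\times_QJ^1Q$. The form $H$ is weakly associated with $L$ if the equality $\widehat H^*L_H=\widehat H^*L$, that is, $$p_i\frac{\partial\mathcal H}{\partial p_i}-\mathcal H=\mathcal L\Bigl(t,q^j,\frac{\partial\mathcal H}{\partial p_j}\Bigr),$$ holds at all points of $N_L$. Then a Hamiltonian form weakly associated with $L$ exists if and only if $\widehat L:J^1Q\to N_L$ admits a global section, i.e. a smooth map $s:N_L\to J^1Q$ with $\widehat L\circ s=\mathrm{Id}_{N_L}$. The same equivalence holds if a weakly associated Hamiltonian form is required to satisfy, in addition, the relation $\widehat L\circ\widehat H\circ\widehat L=\widehat L$. -/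

import Mathlib

open Set Bundle Manifold
open scoped ContDiff Topology

universe u

noncomputable section

/-- The model space `ℝᵐ`. -/
abbrev Euc (m : ℕ) : Type := EuclideanSpace ℝ (Fin m)

/-- A smooth map `p : Y → X` is a smooth fibre bundle: every point of `X` has a neighbourhood over
which `p` is diffeomorphic to a product with a (nonempty) smooth manifold `F`, the typical fibre. -/
def IsSmoothFibreBundle {E H E' H' : Type*} {Y : Type u} {X : Type*}
    [NormedAddCommGroup E] [NormedSpace ℝ E] [TopologicalSpace H]
    [NormedAddCommGroup E'] [NormedSpace ℝ E'] [TopologicalSpace H']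
    (I : ModelWithCorners ℝ E H) (I' : ModelWithCorners ℝ E' H')
    [TopologicalSpace Y] [ChartedSpace H Y] [TopologicalSpace X] [ChartedSpace H' X]
    (p : Y → X) : Prop :=
  ∀ x : X, ∃ (d : ℕ) (F : Type u) (_ : TopologicalSpace F) (_ : ChartedSpace (Euc d) F)
    (_ : IsManifold 𝓘(ℝ, Euc d) ∞ F) (_ : Nonempty F) (e : Trivialization F p),
    x ∈ e.baseSet ∧
    ContMDiffOn I (I'.prod 𝓘(ℝ, Euc d)) ∞ e e.source ∧
    ContMDiffOn (I'.prod 𝓘(ℝ, Euc d)) I ∞ e.toOpenPartialHomeomorph.symm e.target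

/-- A manifold `Q` of dimension `m + 1` fibred over the time axis `ℝ`: a map `time : Q → ℝ`
together with an atlas of fibred coordinates `(t, q¹, …, qᵐ)`, that is, of charts whose first
coordinate is `time`. -/
class TimeFibred (m : ℕ) (Q : Type*) [TopologicalSpace Q] [ChartedSpace (ℝ × Euc m) Q] where
  /-- The projection of `Q` onto the time axis. -/
  time : Q → ℝ
  chart_fst : ∀ e ∈ atlas (ℝ × Euc m) Q, ∀ x ∈ e.source, (e x).1 = time x

/-- The model with corners of a configuration space. -/
abbrev modelQ (m : ℕ) : ModelWithCorners ℝ (ℝ × Euc m) (ℝ × Euc m) := 𝓘(ℝ, ℝ × Euc m)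

section Bundles

variable (m : ℕ) (Q : Type*) [TopologicalSpace Q] [ChartedSpace (ℝ × Euc m) Q]
  [IsManifold (modelQ m) ∞ Q]

/-- Jacobian matrix at `x` of the transition from the chart `i` to the chart `j`. -/
abbrev jac (i j : atlas (ℝ × Euc m) Q) (x : Q) : (ℝ × Euc m) →L[ℝ] (ℝ × Euc m) :=
  (tangentBundleCore (modelQ m) Q).coordChange i j x

variable {m Q} in
/-- Transition functions preserve the time coordinate: `dt' = dt`. -/
theorem jac_fst [TimeFibred m Q] (i j : atlas (ℝ × Euc m) Q) (x : Q) (hi : x ∈ i.1.source)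
    (hj : x ∈ j.1.source) (v : ℝ × Euc m) : (jac m Q i j x v).1 = v.1 := by
  have h2 : (tangentBundleCore (modelQ m) Q).coordChange i j x
      = fderiv ℝ (j.1 ∘ i.1.symm) (i.1 x) := by
    rw [tangentBundleCore_coordChange]
    simp [fderivWithin_univ]
  have hd : DifferentiableAt ℝ (j.1 ∘ i.1.symm) (i.1 x) := by
    have h := (modelQ m).contDiffWithinAt_extendCoordChange' (n := ∞)
      (IsManifold.subset_maximalAtlas i.2) (IsManifold.subset_maximalAtlas j.2) hi hj
    have h' := h.differentiableWithinAt (by simp)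
    simpa [differentiableWithinAt_univ] using h'
  have h1 : (fun y => ((j.1 ∘ i.1.symm) y).1) =ᶠ[𝓝 (i.1 x)] Prod.fst := by
    have hs : IsOpen (i.1.symm ≫ₕ j.1).source := (i.1.symm ≫ₕ j.1).open_source
    have hx : i.1 x ∈ (i.1.symm ≫ₕ j.1).source := by simp [hi, hj]
    filter_upwards [hs.mem_nhds hx] with y hy
    simp only [OpenPartialHomeomorph.trans_source, OpenPartialHomeomorph.symm_source,
      mem_inter_iff, mem_preimage] at hy
    rw [Function.comp_apply, TimeFibred.chart_fst _ j.2 _ hy.2,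
      ← TimeFibred.chart_fst _ i.2 _ (i.1.map_target hy.1), i.1.right_inv hy.1]
  have h3 : fderiv ℝ (fun y => ((j.1 ∘ i.1.symm) y).1) (i.1 x) v
      = (fderiv ℝ (j.1 ∘ i.1.symm) (i.1 x) v).1 := by
    rw [fderiv.fst hd]; rfl
  rw [jac, h2, ← h3, h1.fderiv_eq, fderiv_fst]
  rfl

theorem contMDiffOn_jac (i j : atlas (ℝ × Euc m) Q) :
    ContMDiffOn (modelQ m) 𝓘(ℝ, (ℝ × Euc m) →L[ℝ] (ℝ × Euc m)) ∞ (jac m Q i j)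
      (i.1.source ∩ j.1.source) := by
  have : IsManifold (modelQ m) (∞ + 1) Q := ‹IsManifold (modelQ m) ∞ Q›
  have : (tangentBundleCore (modelQ m) Q).IsContMDiff (modelQ m) ∞ :=
    tangentBundleCore.isContMDiff
  exact (tangentBundleCore (modelQ m) Q).contMDiffOn_coordChange (modelQ m) i j

theorem continuousOn_jac (i j : atlas (ℝ × Euc m) Q) :
    ContinuousOn (jac m Q i j) (i.1.source ∩ j.1.source) :=
  (contMDiffOn_jac m Q i j).continuousOn

variable [TimeFibred m Q]

/-- Transition functions of the vertical tangent bundle `VQ = Ker (T time)`: in fibred coordinates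
`q̇'ⁱ = q̇ʲ ∂ⱼ q'ⁱ`. As for Mathlib's `TangentSpace`, the fibre over `x` is `ℝᵐ`, through the
coordinates of the preferred chart at `x`. -/
def verticalCore : VectorBundleCore ℝ Q (Euc m) (atlas (ℝ × Euc m) Q) where
  baseSet i := i.1.source
  isOpen_baseSet i := i.1.open_source
  indexAt := achart (ℝ × Euc m)
  mem_baseSet_at := mem_chart_source (ℝ × Euc m)
  coordChange i j x := (ContinuousLinearMap.snd ℝ ℝ (Euc m)).comp
    ((jac m Q i j x).comp (ContinuousLinearMap.inr ℝ ℝ (Euc m)))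
  coordChange_self i x hx v := by
    have := (tangentBundleCore (modelQ m) Q).coordChange_self i x hx (0, v)
    exact congrArg Prod.snd this
  continuousOn_coordChange i j :=
    continuousOn_const.clm_comp ((continuousOn_jac m Q i j).clm_comp continuousOn_const)
  coordChange_comp i j k x hx v := by
    have h := (tangentBundleCore (modelQ m) Q).coordChange_comp i j k x hx (0, v)
    have h1 : jac m Q i j x (0, v) = (0, (jac m Q i j x (0, v)).2) :=
      Prod.ext (jac_fst i j x hx.1.1 hx.1.2 _) rfl
    change (jac m Q j k x (0, (jac m Q i j x (0, v)).2)).2 = (jac m Q i k x (0, v)).2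
    rw [← h1]
    exact congrArg Prod.snd h

instance : (verticalCore m Q).IsContMDiff (modelQ m) ∞ where
  contMDiffOn_coordChange i j :=
    contMDiffOn_const.clm_comp ((contMDiffOn_jac m Q i j).clm_comp contMDiffOn_const)

/-- Transition functions of the affine jet bundle `J¹Q → Q`: in fibred coordinates
`q'ⁱ_t = (∂_t + qʲ_t ∂ⱼ) q'ⁱ`. The fibre over `x` is `ℝᵐ`, through the jet coordinates `qⁱ_t`
of the preferred chart at `x`; the jet with coordinates `v` is the tangent vector `(1, v)`. -/
def jetCore : FiberBundleCore (atlas (ℝ × Euc m) Q) Q (Euc m) where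
  baseSet i := i.1.source
  isOpen_baseSet i := i.1.open_source
  indexAt := achart (ℝ × Euc m)
  mem_baseSet_at := mem_chart_source (ℝ × Euc m)
  coordChange i j x v := (jac m Q i j x (1, v)).2
  coordChange_self i x hx v := by
    have := (tangentBundleCore (modelQ m) Q).coordChange_self i x hx (1, v)
    exact congrArg Prod.snd this
  continuousOn_coordChange i j :=
    continuous_snd.comp_continuousOn
      (((continuousOn_jac m Q i j).comp continuousOn_fst fun _ h => h.1).clm_apply
        (continuousOn_const.prodMk continuousOn_snd))
  coordChange_comp i j k x hx v := by
    have h := (tangentBundleCore (modelQ m) Q).coordChange_comp i j k x hx (1, v)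
    have h1 : jac m Q i j x (1, v) = (1, (jac m Q i j x (1, v)).2) :=
      Prod.ext (jac_fst i j x hx.1.1 hx.1.2 _) rfl
    rw [← h1]
    exact congrArg Prod.snd h

/-- The velocity space `J¹Q`. -/
abbrev JetBundle : Type _ := TotalSpace (Euc m) (jetCore m Q).Fiber

/-- The phase space `V*Q`, the dual of the vertical tangent bundle. -/
abbrev PhaseSpace : Type _ :=
  TotalSpace (Euc m →L[ℝ] ℝ) (fun x : Q => (verticalCore m Q).Fiber x →L[ℝ] Trivial Q ℝ x)

/-- The cotangent bundle `T*Q`. -/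
abbrev CotangentBundle : Type _ :=
  TotalSpace ((ℝ × Euc m) →L[ℝ] ℝ) (fun x : Q => TangentSpace (modelQ m) x →L[ℝ] Trivial Q ℝ x)

/-- The model with corners of `J¹Q`, in bundle coordinates `(t, qⁱ, qⁱ_t)`. -/
abbrev modelJet : ModelWithCorners ℝ ((ℝ × Euc m) × Euc m) (ModelProd (ℝ × Euc m) (Euc m)) :=
  (modelQ m).prod 𝓘(ℝ, Euc m)

/-- The model with corners of `V*Q`, in bundle coordinates `(t, qⁱ, pᵢ)`. -/
abbrev modelPhase : ModelWithCorners ℝ ((ℝ × Euc m) × (Euc m →L[ℝ] ℝ))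
    (ModelProd (ℝ × Euc m) (Euc m →L[ℝ] ℝ)) :=
  (modelQ m).prod 𝓘(ℝ, Euc m →L[ℝ] ℝ)

/-- The model with corners of `T*Q`, in bundle coordinates `(t, qⁱ, p₀, pᵢ)`. -/
abbrev modelCotangent : ModelWithCorners ℝ ((ℝ × Euc m) × ((ℝ × Euc m) →L[ℝ] ℝ))
    (ModelProd (ℝ × Euc m) ((ℝ × Euc m) →L[ℝ] ℝ)) :=
  (modelQ m).prod 𝓘(ℝ, (ℝ × Euc m) →L[ℝ] ℝ)

/-- The bundle coordinates `(t, qⁱ, qⁱ_t)` of `J¹Q` have smooth transition functions. -/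
instance jetBundle_isManifold : IsManifold (modelJet m) ∞ (JetBundle m Q) := by
  have key : ∀ i j : atlas (ℝ × Euc m) Q, ContMDiffOn ((modelQ m).prod 𝓘(ℝ, Euc m))
      ((modelQ m).prod 𝓘(ℝ, Euc m)) ∞
      (fun p : Q × Euc m => (p.1, (jetCore m Q).coordChange i j p.1 p.2))
      ((i.1.source ∩ j.1.source) ×ˢ univ) := by
    intro i j
    apply contMDiffOn_fst.prodMk
    have h1 : ContMDiffOn ((modelQ m).prod 𝓘(ℝ, Euc m)) 𝓘(ℝ, (ℝ × Euc m) →L[ℝ] (ℝ × Euc m)) ∞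
        (fun p : Q × Euc m => jac m Q i j p.1) ((i.1.source ∩ j.1.source) ×ˢ univ) :=
      (contMDiffOn_jac m Q i j).comp contMDiffOn_fst fun _ h => h.1
    have h2 : ContMDiffOn ((modelQ m).prod 𝓘(ℝ, Euc m)) 𝓘(ℝ, ℝ × Euc m) ∞
        (fun p : Q × Euc m => ((1 : ℝ), p.2)) ((i.1.source ∩ j.1.source) ×ˢ univ) :=
      contMDiffOn_const.prodMk_space contMDiffOn_snd
    exact (ContinuousLinearMap.snd ℝ ℝ (Euc m)).contMDiff.comp_contMDiffOn (h1.clm_apply h2)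
  let P : Pregroupoid (Q × Euc m) :=
    { property := fun f s => ContMDiffOn ((modelQ m).prod 𝓘(ℝ, Euc m))
        ((modelQ m).prod 𝓘(ℝ, Euc m)) ∞ f s
      comp := fun hf hg _ _ _ => hg.comp' hf
      id_mem := contMDiffOn_id
      locality := fun _ h => contMDiffOn_of_locally_contMDiffOn h
      congr := fun _ h hf => hf.congr h }
  have hP : HasGroupoid (JetBundle m Q) P.groupoid := by
    refine hasGroupoid_of_pregroupoid P ?_
    rintro _ _ ⟨_, ⟨i, rfl⟩, rfl⟩ ⟨_, ⟨j, rfl⟩, rfl⟩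
    have h := (jetCore m Q).localTrivAsPartialEquiv_trans i j
    refine ContMDiffOn.congr (f := fun p : Q × Euc m => (p.1, (jetCore m Q).coordChange i j p.1 p.2)) ?_
      (fun p hp => by exact h.2 hp)
    exact (key i j).mono fun p hp => ((h.1 : _ = _).subset hp)
  refine { StructureGroupoid.HasGroupoid.comp P.groupoid ?_ with }
  intro e he
  rw [mem_groupoid_of_pregroupoid] at he
  rw [isLocalStructomorphOn_contDiffGroupoid_iff]
  exact he

end Bundles

section Mechanics

variable {m : ℕ} {Q : Type u} [TopologicalSpace Q] [ChartedSpace (ℝ × Euc m) Q]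
  [IsManifold (modelQ m) ∞ Q] [TimeFibred m Q]

/-- The jet with jet coordinates `v` in the preferred chart at `x`. -/
def mkJet (x : Q) (v : Euc m) : JetBundle m Q := ⟨x, v⟩

/-- The jet coordinates `qⁱ_t` of a jet over `x`, in the preferred chart at `x`. -/
def velocity (v : JetBundle m Q) : Euc m := v.snd

/-- The point of `V*Q` over `x` with momenta `p` in the preferred chart at `x`. -/
def mkPhase (x : Q) (p : Euc m →L[ℝ] ℝ) : PhaseSpace m Q := ⟨x, p⟩

/-- The momenta `pᵢ d̅qⁱ` of a point of `V*Q` over `x`, in the preferred chart at `x`. -/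
def momentum (z : PhaseSpace m Q) : Euc m →L[ℝ] ℝ := z.snd

/-- The components `p₀ dt + pᵢ dqⁱ` of a covector at `x`, in the preferred chart at `x`. -/
def covector (α : CotangentBundle m Q) : (ℝ × Euc m) →L[ℝ] ℝ := α.snd

/-- The canonical projection `ζ : T*Q → V*Q`, `p₀ dt + pᵢ dqⁱ ↦ pᵢ d̅qⁱ`: the restriction of
covectors to vertical vectors. -/
def toPhaseSpace (α : CotangentBundle m Q) : PhaseSpace m Q :=
  mkPhase α.proj ((covector α).comp (ContinuousLinearMap.inr ℝ ℝ (Euc m)))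

/-- The Legendre map `L̂ : J¹Q → V*Q` of a Lagrangian `L = 𝓛 dt`, the derivative of `𝓛` along the
fibres of `J¹Q → Q`: `pᵢ ∘ L̂ = ∂𝓛/∂qⁱ_t`. -/
def legendreMap (L : JetBundle m Q → ℝ) (v : JetBundle m Q) : PhaseSpace m Q :=
  mkPhase v.proj (fderiv ℝ (fun w : Euc m => L (mkJet v.proj w)) (velocity v))

/-- The Lagrangian constraint space `N_L = L̂(J¹Q)`. -/
def constraintSpace (L : JetBundle m Q → ℝ) : Set (PhaseSpace m Q) := range (legendreMap L)

/-- The Legendre map onto the Lagrangian constraint space, `L̂ : J¹Q → N_L`. -/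
def legendreMapOnto (L : JetBundle m Q → ℝ) (v : JetBundle m Q) : constraintSpace L :=
  ⟨legendreMap L v, v, rfl⟩

/-- `L` is almost regular: `N_L`, with the given manifold structure, is a closed imbedded
subbundle of `V*Q → Q`, and `L̂ : J¹Q → N_L` is a fibred manifold (a surjective submersion, the
surjectivity being automatic) with connected fibres. -/
structure IsAlmostRegular (L : JetBundle m Q → ℝ) (k : ℕ)
    [ChartedSpace (Euc k) (constraintSpace L)] : Prop where
  isClosed : IsClosed (constraintSpace L)
  isSmoothEmbedding : IsSmoothEmbedding 𝓘(ℝ, Euc k) (modelPhase m) ∞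
    (Subtype.val : constraintSpace L → PhaseSpace m Q)
  isSmoothFibreBundle : IsSmoothFibreBundle 𝓘(ℝ, Euc k) (modelQ m)
    (fun z : constraintSpace L => z.1.proj)
  isSubmersion : IsSubmersion (modelJet m) 𝓘(ℝ, Euc k) ∞ (legendreMapOnto L)
  isConnected_fibre : ∀ z : constraintSpace L, IsConnected (legendreMapOnto L ⁻¹' {z})

variable (m Q) in
/-- A Hamiltonian form `H = pᵢ dqⁱ - 𝓗 dt` on `V*Q`, the pull-back of the Liouville form of `T*Q`
by a global smooth section of `ζ : T*Q → V*Q`. As a one-form horizontal over `Q`, it is the same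
thing as this section `z ↦ H(z)`, which has coordinates `p₀ = -𝓗`. -/
structure HamiltonianForm where
  toFun : PhaseSpace m Q → CotangentBundle m Q
  contMDiff_toFun : ContMDiff (modelPhase m) (modelCotangent m) ∞ toFun
  toPhaseSpace_toFun : ∀ z, toPhaseSpace (toFun z) = z

/-- The Hamiltonian `𝓗(t, q, p)`, in the coordinates of the preferred chart at the base point. -/
def HamiltonianForm.hamiltonian (H : HamiltonianForm m Q) (z : PhaseSpace m Q) : ℝ :=
  -covector (H.toFun z) (1, 0)

/-- The Hamiltonian map `Ĥ : V*Q → J¹Q`, `qⁱ_t ∘ Ĥ = ∂𝓗/∂pᵢ`, where `∂/∂pᵢ` is the derivative in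
the direction of the covector `dqⁱ`. -/
def HamiltonianForm.hamiltonianMap (H : HamiltonianForm m Q) (z : PhaseSpace m Q) :
    JetBundle m Q :=
  mkJet z.proj (WithLp.toLp 2 fun i : Fin m =>
    fderiv ℝ (fun p : Euc m →L[ℝ] ℝ => H.hamiltonian (mkPhase z.proj p)) (momentum z)
      (EuclideanSpace.proj i))

/-- The Lagrangian `L_H = (pᵢ qⁱ_t - 𝓗) dt` on `V*Q ×_Q J¹Q`, at the point of coordinates `z`, `v`
in the fibres over the same point of `Q`. -/
def HamiltonianForm.lagrangian (H : HamiltonianForm m Q) (z : PhaseSpace m Q) (v : Euc m) : ℝ :=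
  momentum z v - H.hamiltonian z

/-- `H` is weakly associated with `L`: the relation `Ĥ* L_H = Ĥ* L` holds on `N_L`. -/
def IsWeaklyAssociated (H : HamiltonianForm m Q) (L : JetBundle m Q → ℝ) : Prop :=
  ∀ z ∈ constraintSpace L,
    H.lagrangian z (velocity (H.hamiltonianMap z)) = L (H.hamiltonianMap z)

/-- The relation `L̂ ∘ Ĥ ∘ L̂ = L̂`, that is, `L̂ ∘ Ĥ` is the identity on `N_L`. -/
def IsProjecting (H : HamiltonianForm m Q) (L : JetBundle m Q → ℝ) : Prop :=
  legendreMap L ∘ H.hamiltonianMap ∘ legendreMap L = legendreMap L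

/-- The fibred manifold `L̂ : J¹Q → N_L` admits a global (smooth) section. -/
def HasGlobalSection (L : JetBundle m Q → ℝ) (k : ℕ)
    [ChartedSpace (Euc k) (constraintSpace L)] : Prop :=
  ∃ s : constraintSpace L → JetBundle m Q,
    ContMDiff 𝓘(ℝ, Euc k) (modelJet m) ∞ s ∧ ∀ z, legendreMapOnto L (s z) = z

end Mechanics

end

/-!
An almost regular Lagrangian always has both a weakly associated Hamiltonian form, even one with
`L̂ ∘ Ĥ ∘ L̂ = L̂`, and a global section of `L̂ : J¹Q → N_L`; the equivalences follow because all
of their sides hold. This is to be expected, since a weakly associated form exists for every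
Lagrangian: for any smooth section `Γ` of `J¹Q → Q`, the form with Hamiltonian `pᵢ Γⁱ - 𝓛(Γ)` is
one. The content is therefore the existence of the section, together with a Hamiltonian form that
projects onto `N_L`.

On a fibre over a point of `Q` the Legendre map is the gradient `g` of a function, so its
derivative `D` is symmetric. If `W` is a local section of `g` over the image of `g`, then `D(w) =
D(W(g w)) ∘ DW ∘ D(w)`, and by symmetry `|D(w) κ| ≤ C |D(W(g w)) κ|`. For `κ` in the kernel of `D`
at one point of a fibre `g⁻¹(p)`, the right-hand side is `O(|g w - p|)`. By Gronwall's inequality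
`g` stays equal to `p` along the lines with direction `κ` (`fderiv_add_of_mem_ker_hessian`). Hence
the connected fibres of `g` are affine subspaces (`convex_fibre_fderiv`). The local sections come
from the submersion `L̂ : J¹Q → N_L` and local retractions onto the imbedded submanifold `N_L`
(`IsAlmostRegular.exists_local_lift`).

Since the fibres are convex and the transition functions of `J¹Q` are affine, a partition of unity
on `V*Q` glues the local sections to a smooth map `V : V*Q → J¹Q` over `Q` with `L̂ ∘ V = id` on
`N_L` (`IsAlmostRegular.exists_global_lift`). Its restriction to `N_L` is a global section. The
Hamiltonian `𝓗 = pᵢ Vⁱ - 𝓛(V)` has `∂𝓗/∂pᵢ = Vⁱ` at the points of `N_L`, because `∂𝓛/∂qⁱ_t (V) =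
pᵢ` there (`hamiltonianMap_hamiltonianFormOf`). So `Ĥ = V` on `N_L`, and both required relations
follow.
-/

/-! ### Gradient maps with affine fibres -/

section GradientMap

theorem ContDiffAt.exists_eventually_norm_fderiv_apply_le {E F : Type*} [NormedAddCommGroup E]
    [NormedSpace ℝ E] [NormedAddCommGroup F] [NormedSpace ℝ F] {f : E → F} {x : E}
    (hf : ContDiffAt ℝ 1 f x) :
    ∃ C, 0 ≤ C ∧ ∀ᶠ y in 𝓝 x, ∀ v, ‖fderiv ℝ f y v‖ ≤ C * ‖v‖ :=
  ⟨‖fderiv ℝ f x‖ + 1, by positivity,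
    ((hf.fderiv_right (m := 0) (by simp)).continuousAt.norm.eventually_lt_const
      (lt_add_one _)).mono fun _ h => (fderiv ℝ f _).le_of_opNorm_le h.le⟩

variable {E : Type*} [NormedAddCommGroup E]

/-- A map `W` is a local lift through `g` at `w` if it is `C¹` at `g w`, takes the value `w` there,
and is a section of `g` over the points of `range g` near `g w`. No condition is imposed off the
range of `g`. -/
structure IsLocalLift {F : Type*} [NormedAddCommGroup F] [NormedSpace ℝ E] [NormedSpace ℝ F]
    (g : E → F) (W : F → E) (w : E) : Prop where
  contDiffAt : ContDiffAt ℝ 1 W (g w)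
  apply_eq : W (g w) = w
  eventually : ∀ᶠ p in 𝓝 (g w), p ∈ range g → g (W p) = p

variable [InnerProductSpace ℝ E] {f : E → ℝ}

/-- With `D` the Hessian of `f` and `W` a local lift through the gradient `g`, the chain rule
applied to `g ∘ W ∘ g = g` and the symmetry of `D` bound `D(w) κ` by `D(W (g w)) κ`. -/
theorem eventually_norm_hessian_apply_le (hf : ContDiff ℝ ∞ f) {W : (E →L[ℝ] ℝ) → E} {w₀ w₁ : E}
    (hW : IsLocalLift (fderiv ℝ f) W w₀) (h₁ : fderiv ℝ f w₁ = fderiv ℝ f w₀) :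
    ∃ C : ℝ, ∀ᶠ w in 𝓝 w₁, ∀ κ : E, ‖fderiv ℝ (fderiv ℝ f) w κ‖ ≤
      C * ‖fderiv ℝ (fderiv ℝ f) (W (fderiv ℝ f w)) κ‖ := by
  have hg : ContDiff ℝ ∞ (fderiv ℝ f) := hf.fderiv_right (by simp)
  have hgd : Differentiable ℝ (fderiv ℝ f) := hg.differentiable (by simp)
  set g := fderiv ℝ f with hgdef
  set D := fderiv ℝ g with hDdef
  have hsymm : ∀ w a b, D w a b = D w b a := fun w a b =>
    (hf.contDiffAt (x := w)).isSymmSndFDerivAt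
      (by simpa using (by exact_mod_cast le_top : ((2 : ℕ∞) : WithTop ℕ∞) ≤ ∞)) a b
  have htend : Filter.Tendsto g (𝓝 w₁) (𝓝 (g w₀)) := h₁ ▸ hg.continuous.tendsto w₁
  have hWd : ∀ᶠ p in 𝓝 (g w₀), DifferentiableAt ℝ W p :=
    (hW.contDiffAt.eventually (by simp)).mono fun p hp => hp.differentiableAt (by simp)
  obtain ⟨C, hC0, hC⟩ := hW.contDiffAt.exists_eventually_norm_fderiv_apply_le
  obtain ⟨C', hC'0, hC'⟩ :=
    (hg.contDiffAt (x := w₁).of_le (by simp)).exists_eventually_norm_fderiv_apply_le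
  refine ⟨C * C', ?_⟩
  have hid : ∀ᶠ w in 𝓝 w₁, ∀ᶠ w' in 𝓝 w, g (W (g w')) = g w' :=
    ((htend.eventually hW.eventually).mono fun w hw => hw (mem_range_self w)).eventually_nhds
  filter_upwards [htend.eventually hC, hC', hid, htend.eventually hWd] with w hw hwD hw' hwd κ
  -- The chain rule for `g ∘ W ∘ g = g`.
  have hchain : D w = (D (W (g w))).comp ((fderiv ℝ W (g w)).comp (D w)) := by
    have h1 : HasFDerivAt (fun w => g (W (g w)))
        ((D (W (g w))).comp ((fderiv ℝ W (g w)).comp (D w))) w :=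
      (hgd _).hasFDerivAt.comp w (hwd.hasFDerivAt.comp w (hgd w).hasFDerivAt)
    exact (h1.congr_of_eventuallyEq (hw'.mono fun _ h => h.symm)).fderiv
  refine ContinuousLinearMap.opNorm_le_bound _ (by positivity) fun b => ?_
  have : D w κ b = D (W (g w)) κ (fderiv ℝ W (g w) (D w b)) := by
    rw [hsymm w κ b]
    conv_lhs => rw [hchain]
    exact hsymm _ _ _
  rw [this]
  calc _ ≤ ‖D (W (g w)) κ‖ * ‖fderiv ℝ W (g w) (D w b)‖ := ContinuousLinearMap.le_opNorm _ _
    _ ≤ ‖D (W (g w)) κ‖ * (C * (C' * ‖b‖)) := by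
      gcongr
      exact (hw _).trans (by gcongr; exact hwD b)
    _ = _ := by ring

/-- Fibres of a gradient map with local lifts are invariant under translation by the kernel of the
Hessian: along such a line the gradient satisfies a linear differential inequality. -/
theorem fderiv_add_of_mem_ker_hessian (hf : ContDiff ℝ ∞ f) {W : (E →L[ℝ] ℝ) → E} {w₀ w₁ κ : E}
    (hW : IsLocalLift (fderiv ℝ f) W w₀) (h₁ : fderiv ℝ f w₁ = fderiv ℝ f w₀)
    (hκ : fderiv ℝ (fderiv ℝ f) w₀ κ = 0) : fderiv ℝ f (w₁ + κ) = fderiv ℝ f w₀ := by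
  have hg : ContDiff ℝ ∞ (fderiv ℝ f) := hf.fderiv_right (by simp)
  have hgd : Differentiable ℝ (fderiv ℝ f) := hg.differentiable (by simp)
  set g := fderiv ℝ f with hgdef
  set D := fderiv ℝ g with hDdef
  have hD1 : ContDiff ℝ 1 D := hg.fderiv_right (m := 1)
    (by simpa [one_add_one_eq_two] using (by exact_mod_cast le_top : ((2 : ℕ∞) : WithTop ℕ∞) ≤ ∞))
  obtain ⟨M, t, ht, hM⟩ : ∃ M, ∃ t ∈ 𝓝 (g w₀), LipschitzOnWith M (fun p => D (W p) κ) t := by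
    have : ContDiffAt ℝ 1 (fun p => D (W p) κ) (g w₀) :=
      (hD1.contDiffAt.comp _ hW.contDiffAt).clm_apply contDiffAt_const
    exact this.exists_lipschitzOnWith
  have key : ∀ w, g w = g w₀ → ∃ C : ℝ, ∀ᶠ w' in 𝓝 w, ‖D w' κ‖ ≤ C * ‖g w' - g w₀‖ := by
    intro w hw
    obtain ⟨C, hC⟩ := eventually_norm_hessian_apply_le hf hW hw
    refine ⟨|C| * M, ?_⟩
    have htend : Filter.Tendsto g (𝓝 w) (𝓝 (g w₀)) := hw ▸ hg.continuous.tendsto w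
    filter_upwards [hC, htend ht] with w' h1 h2
    have h3 := hM.norm_sub_le h2 (mem_of_mem_nhds ht)
    simp only [hW.apply_eq, hκ, sub_zero] at h3
    calc ‖D w' κ‖ ≤ C * ‖D (W (g w')) κ‖ := h1 κ
      _ ≤ |C| * ‖D (W (g w')) κ‖ := by gcongr; exact le_abs_self C
      _ ≤ |C| * (M * ‖g w' - g w₀‖) := by gcongr
      _ = _ := by ring
  -- Continuous induction along the segment from `w₁` to `w₁ + κ`: the set where `g = g w₀` is
  -- closed, and, by Gronwall's inequality for `g - g w₀`, open on the right.
  let S : Set ℝ := {s | g (w₁ + s • κ) = g w₀}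
  have hcont : Continuous fun s : ℝ => g (w₁ + s • κ) := hg.continuous.comp (by fun_prop)
  have hS : IsClosed S := isClosed_eq hcont continuous_const
  have hsub : Icc (0 : ℝ) 1 ⊆ S := by
    refine IsClosed.Icc_subset_of_forall_mem_nhdsWithin (hS.inter isClosed_Icc)
      (by simpa [S] using h₁) ?_
    rintro x ⟨hx, -⟩
    obtain ⟨C, hC⟩ := key _ hx
    have hline : Continuous fun s : ℝ => w₁ + s • κ := by fun_prop
    have hC' : ∀ᶠ s in 𝓝 x, ‖D (w₁ + s • κ) κ‖ ≤ C * ‖g (w₁ + s • κ) - g w₀‖ :=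
      (hline.tendsto x).eventually hC
    obtain ⟨ε, hε, hball⟩ := Metric.eventually_nhds_iff_ball.1 hC'
    have hzero := eq_zero_of_abs_deriv_le_mul_abs_self_of_eq_zero_right
      (f := fun s : ℝ => g (w₁ + s • κ) - g w₀) (f' := fun s => D (w₁ + s • κ) κ) (K := C)
      (a := x) (b := x + ε / 2) (hcont.sub continuous_const).continuousOn
      (fun s _ => by
        have h1 : HasDerivAt (fun s : ℝ => w₁ + s • κ) κ s := by
          simpa using ((hasDerivAt_id s).smul_const κ).const_add w₁
        exact (((hgd _).hasFDerivAt.comp_hasDerivAt s h1).sub_const _).hasDerivWithinAt)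
      (sub_eq_zero.2 hx)
      (fun s hs => hball s (by
        rw [Metric.mem_ball, Real.dist_eq, abs_lt]
        constructor <;> linarith [hs.1, hs.2]))
    filter_upwards [Ioo_mem_nhdsGT (show x < x + ε / 2 by linarith)] with s hs
    exact sub_eq_zero.1 (hzero s ⟨hs.1.le, hs.2.le⟩)
  simpa [S] using hsub (right_mem_Icc.2 zero_le_one)

/-- If every point of the domain of a gradient map admits a local lift, then its connected fibres
are affine subspaces, in particular convex: a fibre is locally, hence by connectedness globally,
a translate of the kernel of the Hessian. -/
theorem convex_fibre_fderiv [FiniteDimensional ℝ E] (hf : ContDiff ℝ ∞ f)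
    (hlift : ∀ w, ∃ W : (E →L[ℝ] ℝ) → E, IsLocalLift (fderiv ℝ f) W w) (p : E →L[ℝ] ℝ)
    (hp : IsPreconnected (fderiv ℝ f ⁻¹' {p})) : Convex ℝ (fderiv ℝ f ⁻¹' {p}) := by
  have hg : ContDiff ℝ ∞ (fderiv ℝ f) := hf.fderiv_right (by simp)
  have hgd : Differentiable ℝ (fderiv ℝ f) := hg.differentiable (by simp)
  have htrans : ∀ w₀ ∈ fderiv ℝ f ⁻¹' {p}, ∀ w₁ ∈ fderiv ℝ f ⁻¹' {p}, ∀ κ,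
      fderiv ℝ (fderiv ℝ f) w₀ κ = 0 → w₁ + κ ∈ fderiv ℝ f ⁻¹' {p} := by
    intro w₀ h₀ w₁ h₁ κ hκ
    obtain ⟨W, hW⟩ := hlift w₀
    exact (fderiv_add_of_mem_ker_hessian hf hW (h₁.trans h₀.symm) hκ).trans h₀
  set g := fderiv ℝ f with hgdef
  set D := fderiv ℝ g with hDdef
  -- All points of the fibre have the same Hessian kernel, `g` being constant along its directions.
  have hker : ∀ w₀ ∈ g ⁻¹' {p}, ∀ w₁ ∈ g ⁻¹' {p}, ∀ κ, D w₀ κ = 0 → D w₁ κ = 0 := by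
    intro w₀ h₀ w₁ h₁ κ hκ
    have h1 : HasDerivAt (fun s : ℝ => w₁ + s • κ) κ 0 := by
      simpa using ((hasDerivAt_id (0 : ℝ)).smul_const κ).const_add w₁
    have h2 : HasDerivAt (fun s : ℝ => g (w₁ + s • κ)) (D w₁ κ) 0 := by
      have h : HasFDerivAt g (D w₁) (w₁ + (0 : ℝ) • κ) := by
        simpa using (hgd w₁).hasFDerivAt
      exact h.comp_hasDerivAt (0 : ℝ) h1
    have h3 : (fun s : ℝ => g (w₁ + s • κ)) = fun _ => p :=
      funext fun s => htrans w₀ h₀ w₁ h₁ (s • κ) (by simp [hκ])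
    rw [h3] at h2
    exact h2.unique (hasDerivAt_const _ _)
  -- Near a point `w₁` of the fibre, the translation by the kernel component of `w - w₁` reduces to
  -- the directions orthogonal to the kernel, on which the derivative of `g` is injective.
  have hloc : ∀ w₁ ∈ g ⁻¹' {p}, ∀ᶠ w in 𝓝[g ⁻¹' {p}] w₁, D w₁ (w - w₁) = 0 := by
    intro w₁ h₁
    let K : Submodule ℝ E := (D w₁).ker
    have hA : ∃ C, AntilipschitzWith C ((D w₁).comp Kᗮ.subtypeL) := by
      obtain ⟨C, -, hC⟩ := LinearMap.exists_antilipschitzWith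
        ((D w₁).comp Kᗮ.subtypeL).toLinearMap (by
          rw [LinearMap.ker_eq_bot']
          rintro ⟨x, hx⟩ h
          have hxK : x ∈ K := h
          have : x = 0 := by
            have := K.inf_orthogonal_eq_bot
            exact (Submodule.mem_bot ℝ).1 (this ▸ ⟨hxK, hx⟩)
          simpa using this)
      exact ⟨C, hC⟩
    have hder : HasFDerivAt (fun η : Kᗮ => g (w₁ + η)) ((D w₁).comp Kᗮ.subtypeL) 0 := by
      have h1 : HasFDerivAt (fun η : Kᗮ => w₁ + (η : E)) Kᗮ.subtypeL 0 :=
        Kᗮ.subtypeL.hasFDerivAt.const_add w₁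
      have h2 : HasFDerivAt g (D w₁) (w₁ + ((0 : Kᗮ) : E)) := by
        simpa using (hgd w₁).hasFDerivAt
      exact h2.comp (0 : Kᗮ) h1
    have hne := hder.eventually_ne (c := p) hA
    rw [eventually_nhdsWithin_iff] at hne
    have hproj : Filter.Tendsto (fun w => Kᗮ.orthogonalProjectionOnto (w - w₁)) (𝓝 w₁) (𝓝 0) := by
      have : Continuous fun w => Kᗮ.orthogonalProjectionOnto (w - w₁) := by fun_prop
      simpa using this.tendsto w₁
    rw [eventually_nhdsWithin_iff]
    filter_upwards [hproj.eventually hne] with w hw hwp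
    set η := Kᗮ.orthogonalProjectionOnto (w - w₁) with hη
    have hκ : (w - w₁) - η ∈ K := by
      have := Submodule.sub_starProjection_mem_orthogonal (K := Kᗮ) (w - w₁)
      rwa [Submodule.orthogonal_orthogonal] at this
    have hκ' : D w₁ ((w - w₁) - η) = 0 := hκ
    have hmem : w₁ + (η : E) ∈ g ⁻¹' {p} := by
      have := htrans w₁ h₁ w hwp (-((w - w₁) - η)) (by rw [map_neg, hκ', neg_zero])
      convert this using 1
      abel
    have hη0 : η = 0 := by
      by_contra hne
      exact hw hne hmem
    have : w - w₁ ∈ K := by simpa [hη0] using hκ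
    exact this
  -- Connectedness makes the local statement global.
  have hall : ∀ w₀ ∈ g ⁻¹' {p}, ∀ w₁ ∈ g ⁻¹' {p}, D w₀ (w₁ - w₀) = 0 := by
    intro w₀ h₀ w₁ h₁
    have := hp.induction₂ (fun x y => D w₀ (y - x) = 0)
      (fun x hx => by
        filter_upwards [hloc x hx, self_mem_nhdsWithin] with y hy _
        exact hker x hx w₀ h₀ _ hy)
      (fun x y z _ _ _ hxy hyz => by
        rw [← sub_add_sub_cancel z y x, map_add, hxy, hyz, add_zero])
      (fun x y _ _ hxy => by rw [← neg_sub, map_neg, hxy, neg_zero]) h₀ h₁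
    exact this
  rw [convex_iff_add_mem]
  intro x hx y hy a b _ _ hab
  have := htrans x hx x hx (b • (y - x)) (by rw [map_smul, hall x hx y hy, smul_zero])
  convert this using 1
  rw [← eq_sub_iff_add_eq] at hab
  subst hab
  module

end GradientMap

/-! ### Local sections of submersions and local retractions of embeddings -/

section LocalSections

variable {E E' H H' M N : Type*}
  [NormedAddCommGroup E] [NormedSpace ℝ E] [NormedAddCommGroup E'] [NormedSpace ℝ E']
  [TopologicalSpace H] [TopologicalSpace H']
  {I : ModelWithCorners ℝ E H} {J : ModelWithCorners ℝ E' H'}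
  [TopologicalSpace M] [ChartedSpace H M]
  [TopologicalSpace N] [ChartedSpace H' N]

/-- A submersion admits a smooth local section through every point of its domain. -/
theorem Manifold.IsSubmersionAt.exists_local_section [I.Boundaryless] [J.Boundaryless]
    {f : M → N} {x : M} (h : IsSubmersionAt I J ∞ f x) :
    ∃ (O : Set N) (s : N → M), IsOpen O ∧ f x ∈ O ∧ ContMDiffOn J I ∞ s O ∧ s (f x) = x ∧
      ∀ y ∈ O, f (s y) = y := by
  set φ := h.domChart
  set ψ := h.codChart
  set e := h.equiv
  let c : N → E := fun y => e.symm (ψ.extend J y, (e (φ.extend I x)).2)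
  have hcs : ContMDiffOn J 𝓘(ℝ, E) ∞ c ψ.source := by
    refine e.symm.contDiff.contMDiff.comp_contMDiffOn
      (ContMDiffOn.prodMk_space ?_ contMDiffOn_const)
    exact OpenPartialHomeomorph.contMDiffOn_extend h.codChart_mem_maximalAtlas
  have hx : x ∈ φ.source := h.mem_domChart_source
  have hxt : φ.extend I x ∈ (φ.extend I).target :=
    (φ.extend I).map_source (by rwa [φ.extend_source])
  have hxl : (φ.extend I).symm (φ.extend I x) = x := φ.extend_left_inv hx
  have hcx : c (f x) = φ.extend I x := by
    have := h.writtenInCharts hxt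
    simp only [Function.comp_apply] at this
    rw [hxl] at this
    change e.symm (ψ.extend J (f x), _) = _
    rw [this]
    exact e.symm_apply_apply _
  refine ⟨ψ.source ∩ c ⁻¹' (φ.extend I).target, fun y => (φ.extend I).symm (c y),
    hcs.continuousOn.isOpen_inter_preimage ψ.open_source φ.isOpen_extend_target,
    ⟨h.mem_codChart_source, by rw [mem_preimage, hcx]; exact hxt⟩, ?_, ?_, ?_⟩
  · have := contMDiffOn_extend_symm (n := ∞) h.domChart_mem_maximalAtlas
    rw [← OpenPartialHomeomorph.extend_target'] at this
    exact this.comp (hcs.mono inter_subset_left) fun y hy => hy.2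
  · simp only [hcx, hxl]
  · rintro y ⟨hy, hyt⟩
    have hw := h.writtenInCharts hyt
    simp only [Function.comp_apply] at hw
    have hs : (φ.extend I).symm (c y) ∈ φ.source := by
      rw [← φ.extend_source (I := I)]
      exact (φ.extend I).map_target hyt
    refine (ψ.extend J).injOn (by rw [ψ.extend_source]; exact h.source_subset_preimage_source hs)
      (by rwa [ψ.extend_source]) (hw.trans ?_)
    change (e (e.symm _)).1 = _
    rw [e.apply_symm_apply]

/-- A smooth embedding admits a smooth local retraction near every point of its image. -/
theorem Manifold.IsSmoothEmbedding.exists_local_retraction [I.Boundaryless] [J.Boundaryless]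
    {f : M → N} (hf : IsSmoothEmbedding I J ∞ f) (x : M) :
    ∃ (O : Set N) (r : N → M), IsOpen O ∧ f x ∈ O ∧ ContMDiffOn J I ∞ r O ∧
      ∀ y, f y ∈ O → r (f y) = y := by
  have h := hf.isImmersion.isImmersionAt x
  set φ := h.domChart
  set ψ := h.codChart
  set e := h.equiv
  let c : N → E := fun y => (e.symm (ψ.extend J y)).1
  have hcs : ContMDiffOn J 𝓘(ℝ, E) ∞ c ψ.source := by
    refine (contDiff_fst.comp e.symm.contDiff).contMDiff.comp_contMDiffOn ?_
    exact OpenPartialHomeomorph.contMDiffOn_extend h.codChart_mem_maximalAtlas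
  have hc : ∀ y ∈ φ.source, c (f y) = φ.extend I y := by
    intro y hy
    have hyt : φ.extend I y ∈ (φ.extend I).target :=
      (φ.extend I).map_source (by rwa [φ.extend_source])
    have hw := h.writtenInCharts hyt
    simp only [Function.comp_apply] at hw
    rw [φ.extend_left_inv hy] at hw
    change (e.symm (ψ.extend J (f y))).1 = _
    rw [hw]
    simp [e]
  have hx : x ∈ φ.source := h.mem_domChart_source
  -- As `f` is a topological embedding, only points of `φ.source` have images close to `f x`.
  obtain ⟨O, hO, hOφ⟩ := hf.isEmbedding.isInducing.isOpen_iff.1 φ.open_source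
  refine ⟨O ∩ (ψ.source ∩ c ⁻¹' (φ.extend I).target), fun y => (φ.extend I).symm (c y),
    hO.inter (hcs.continuousOn.isOpen_inter_preimage ψ.open_source φ.isOpen_extend_target),
    ⟨hOφ.symm.subset hx, h.mem_codChart_source, ?_⟩, ?_, ?_⟩
  · rw [mem_preimage, hc x hx]
    exact (φ.extend I).map_source (by rwa [φ.extend_source])
  · have := contMDiffOn_extend_symm (n := ∞) h.domChart_mem_maximalAtlas
    rw [← OpenPartialHomeomorph.extend_target'] at this
    exact this.comp (hcs.mono fun y hy => hy.2.1) fun y hy => hy.2.2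
  · rintro y ⟨hy, -⟩
    have hyφ : y ∈ φ.source := hOφ.subset hy
    simp only [hc y hyφ]
    exact φ.extend_left_inv hyφ

end LocalSections

/-! ### Topology of the total space of a fibre bundle -/

section TotalSpaceTopology

variable {B F : Type*} {E : B → Type*} [TopologicalSpace B] [TopologicalSpace F]
  [TopologicalSpace (TotalSpace F E)] [∀ b, TopologicalSpace (E b)] [FiberBundle F E]

theorem FiberBundle.t2Space_totalSpace [T2Space B] [T2Space F] : T2Space (TotalSpace F E) := by
  refine ⟨fun x y hxy => ?_⟩
  by_cases h : x.proj = y.proj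
  · set e := trivializationAt F E x.proj
    have hx : x ∈ e.source := FiberBundle.mem_trivializationAt_proj_source
    have hy : y ∈ e.source :=
      e.mem_source.2 (h ▸ FiberBundle.mem_baseSet_trivializationAt F E x.proj)
    obtain ⟨u, v, hu, hv, hxu, hyv, huv⟩ := t2_separation (e.injOn.ne hx hy hxy)
    exact ⟨e.source ∩ e ⁻¹' u, e.source ∩ e ⁻¹' v,
      e.continuousOn.isOpen_inter_preimage e.open_source hu,
      e.continuousOn.isOpen_inter_preimage e.open_source hv, ⟨hx, hxu⟩, ⟨hy, hyv⟩,
      (huv.preimage e).mono inter_subset_right inter_subset_right⟩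
  · exact separated_by_continuous (FiberBundle.continuous_proj F E) h

theorem FiberBundle.secondCountableTopology_totalSpace {H : Type*} [TopologicalSpace H]
    [ChartedSpace H B] [SecondCountableTopology B] [SecondCountableTopology H]
    [SecondCountableTopology F] [Nonempty F] : SecondCountableTopology (TotalSpace F E) := by
  obtain ⟨s, hs, hsu⟩ := TopologicalSpace.countable_cover_nhds
    (f := fun b : B => (trivializationAt F E b).baseSet)
    fun b => (trivializationAt F E b).open_baseSet.mem_nhds (mem_baseSet_trivializationAt F E b)
  have : SecondCountableTopology (B × F) := inferInstance
  let z : B → TotalSpace F E := fun b =>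
    (trivializationAt F E b).toOpenPartialHomeomorph.symm (b, Classical.arbitrary F)
  have hz : ∀ b, (z b).proj = b := fun b =>
    (trivializationAt F E b).proj_symm_apply' (mem_baseSet_trivializationAt F E b)
  refine ChartedSpace.secondCountable_of_countable_cover (B × F) (s := z '' s) ?_ (hs.image z)
  rw [eq_univ_iff_forall]
  intro x
  obtain ⟨b, hb, hxb⟩ := mem_iUnion₂.1 (hsu.symm.subset (mem_univ x.proj))
  refine mem_iUnion₂.2 ⟨z b, mem_image_of_mem z hb, ?_⟩
  rw [FiberBundle.chartedSpace'_chartAt, hz]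
  exact (Trivialization.mem_source _).2 hxb

end TotalSpaceTopology

noncomputable section

/-! ### Coordinates on `J¹Q`, `V*Q` and `T*Q` -/

section Coordinates

variable {m : ℕ} {Q : Type u} [TopologicalSpace Q] [ChartedSpace (ℝ × Euc m) Q]
  [IsManifold (modelQ m) ∞ Q]

theorem jac_self (i : atlas (ℝ × Euc m) Q) {x : Q} (hi : x ∈ i.1.source) (v : ℝ × Euc m) :
    jac m Q i i x v = v :=
  (tangentBundleCore (modelQ m) Q).coordChange_self i x hi v

theorem jac_jac (i j k : atlas (ℝ × Euc m) Q) {x : Q} (hi : x ∈ i.1.source) (hj : x ∈ j.1.source)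
    (hk : x ∈ k.1.source) (v : ℝ × Euc m) : jac m Q j k x (jac m Q i j x v) = jac m Q i k x v :=
  (tangentBundleCore (modelQ m) Q).coordChange_comp i j k x ⟨⟨hi, hj⟩, hk⟩ v

variable [TimeFibred m Q]

/-- The jet coordinates `qⁱ_t` of a jet in the preferred chart at `q`, for a jet over the domain of
this chart (a junk value for other jets). -/
def velocityAt (q : Q) (v : JetBundle m Q) : Euc m :=
  (jac m Q (achart _ v.proj) (achart _ q) v.proj (1, velocity v)).2

/-- The jet over `x` with jet coordinates `w` in the preferred chart at `q`, for `x` in the domain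
of this chart. Its base point is `x` in all cases. -/
def jetOfCoord (q x : Q) (w : Euc m) : JetBundle m Q :=
  mkJet x (jac m Q (achart _ q) (achart _ x) x (1, w)).2

/-- The momenta `pᵢ` of a point of `V*Q` in the preferred chart at `q`, for a point over the domain
of this chart (a junk value for other points). -/
def momentumAt (q : Q) (z : PhaseSpace m Q) : Euc m →L[ℝ] ℝ :=
  (momentum z).comp ((verticalCore m Q).coordChange (achart _ q) (achart _ z.proj) z.proj)

/-- The point of `T*Q` over `x` with components `α` in the preferred chart at `x`. -/
def mkCovector (x : Q) (α : (ℝ × Euc m) →L[ℝ] ℝ) : CotangentBundle m Q := ⟨x, α⟩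

theorem one_velocityAt {q : Q} {v : JetBundle m Q} (hq : v.proj ∈ (chartAt (ℝ × Euc m) q).source) :
    (1, velocityAt q v) = jac m Q (achart _ v.proj) (achart _ q) v.proj (1, velocity v) :=
  Prod.ext (jac_fst (achart _ v.proj) (achart _ q) v.proj
    (mem_chart_source (ℝ × Euc m) v.proj) hq (1, velocity v)).symm rfl

theorem velocityAt_eq_jac {q q' : Q} {v : JetBundle m Q}
    (hq : v.proj ∈ (chartAt (ℝ × Euc m) q).source)
    (hq' : v.proj ∈ (chartAt (ℝ × Euc m) q').source) :
    velocityAt q' v = (jac m Q (achart _ q) (achart _ q') v.proj (1, velocityAt q v)).2 := by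
  rw [one_velocityAt hq, jac_jac _ _ _ (mem_chart_source (ℝ × Euc m) v.proj) hq hq']
  rfl

theorem velocityAt_proj (v : JetBundle m Q) : velocityAt v.proj v = velocity v := by
  rw [velocityAt, jac_self _ (mem_chart_source (ℝ × Euc m) v.proj)]

theorem velocityAt_jetOfCoord {q x : Q} (hx : x ∈ (chartAt (ℝ × Euc m) q).source) (w : Euc m) :
    velocityAt q (jetOfCoord q x w) = w := by
  have hxx := mem_chart_source (ℝ × Euc m) x
  have h : (1, (jac m Q (achart _ q) (achart _ x) x (1, w)).2)
      = jac m Q (achart _ q) (achart _ x) x (1, w) :=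
    Prod.ext (jac_fst (achart _ q) (achart _ x) x hx hxx (1, w)).symm rfl
  change (jac m Q (achart _ x) (achart _ q) x
    (1, (jac m Q (achart _ q) (achart _ x) x (1, w)).2)).2 = w
  rw [h, jac_jac _ _ _ hx hxx hx, jac_self _ hx]

theorem jetOfCoord_velocityAt {q : Q} {v : JetBundle m Q}
    (hq : v.proj ∈ (chartAt (ℝ × Euc m) q).source) :
    jetOfCoord q v.proj (velocityAt q v) = v := by
  have hv := mem_chart_source (ℝ × Euc m) v.proj
  rw [jetOfCoord, one_velocityAt hq, jac_jac _ _ _ hv hq hv, jac_self _ hv]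
  rfl

theorem momentumAt_proj (z : PhaseSpace m Q) : momentumAt z.proj z = momentum z := by
  ext v
  exact congrArg (momentum z)
    ((verticalCore m Q).coordChange_self _ _ (mem_chart_source (ℝ × Euc m) z.proj) v)

/-- As the transition functions of `J¹Q` are affine, affine combinations of jets do not depend on
the chart. -/
theorem velocityAt_mkJet_sum {ι : Type*} (s : Finset ι) (a : ι → ℝ) (w : ι → Euc m) (q x : Q)
    (ha : ∑ i ∈ s, a i = 1) : velocityAt q (mkJet x (∑ i ∈ s, a i • w i))
      = ∑ i ∈ s, a i • velocityAt q (mkJet x (w i)) := by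
  have h : ((1, ∑ i ∈ s, a i • w i) : ℝ × Euc m) = ∑ i ∈ s, a i • ((1, w i) : ℝ × Euc m) := by
    ext1
    · simp [Prod.fst_sum, ha]
    · simp [Prod.snd_sum]
  change (jac m Q (achart _ x) (achart _ q) x (1, ∑ i ∈ s, a i • w i)).2 = _
  rw [h, map_sum, Prod.snd_sum]
  exact Finset.sum_congr rfl fun i _ => by rw [map_smul]; rfl

variable {E H M : Type*} [NormedAddCommGroup E] [NormedSpace ℝ E] [TopologicalSpace H]
  {I : ModelWithCorners ℝ E H} [TopologicalSpace M] [ChartedSpace H M]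

/-- Smoothness of jet coordinates does not depend on the chart. -/
theorem ContMDiffAt.velocityAt_change {f : M → JetBundle m Q} {x : M} {q q' : Q}
    (hq : (f x).proj ∈ (chartAt (ℝ × Euc m) q).source)
    (hq' : (f x).proj ∈ (chartAt (ℝ × Euc m) q').source)
    (hf : ContMDiffAt I (modelQ m) ∞ (fun y => (f y).proj) x)
    (hv : ContMDiffAt I 𝓘(ℝ, Euc m) ∞ (fun y => velocityAt q (f y)) x) :
    ContMDiffAt I 𝓘(ℝ, Euc m) ∞ (fun y => velocityAt q' (f y)) x := by
  have hjac : ContMDiffAt I 𝓘(ℝ, (ℝ × Euc m) →L[ℝ] (ℝ × Euc m)) ∞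
      (fun y => jac m Q (achart _ q) (achart _ q') (f y).proj) x :=
    ((contMDiffOn_jac m Q (achart _ q) (achart _ q')).contMDiffAt
      (((chartAt (ℝ × Euc m) q).open_source.inter
        (chartAt (ℝ × Euc m) q').open_source).mem_nhds ⟨hq, hq'⟩)).comp x hf
  have h1 : ContMDiffAt I 𝓘(ℝ, ℝ × Euc m) ∞ (fun y => ((1 : ℝ), velocityAt q (f y))) x :=
    contMDiffAt_const.prodMk_space hv
  have h2 := (ContinuousLinearMap.snd ℝ ℝ (Euc m)).contMDiff.contMDiffAt.comp x (hjac.clm_apply h1)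
  refine h2.congr_of_eventuallyEq ?_
  filter_upwards [hf.continuousAt.eventually_mem
      ((chartAt (ℝ × Euc m) q).open_source.mem_nhds hq),
    hf.continuousAt.eventually_mem
      ((chartAt (ℝ × Euc m) q').open_source.mem_nhds hq')] with y hy hy'
  exact velocityAt_eq_jac hy hy'

/-- A map to `J¹Q` is smooth at a point if its base point and its jet coordinates are, in any chart
around the base point. -/
theorem contMDiffAt_jet_iff {f : M → JetBundle m Q} {x : M} {q : Q}
    (hq : (f x).proj ∈ (chartAt (ℝ × Euc m) q).source) :
    ContMDiffAt I (modelJet m) ∞ f x ↔ ContMDiffAt I (modelQ m) ∞ (fun y => (f y).proj) x ∧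
      ContMDiffAt I 𝓘(ℝ, Euc m) ∞ (fun y => velocityAt q (f y)) x := by
  have hx := mem_chart_source (ℝ × Euc m) (f x).proj
  have h : ContMDiffAt I (modelJet m) ∞ f x ↔ ContMDiffAt I (modelQ m) ∞ (fun y => (f y).proj) x ∧
      ContMDiffAt I 𝓘(ℝ, Euc m) ∞ (fun y => velocityAt (f x).proj (f y)) x :=
    Bundle.contMDiffAt_totalSpace
  rw [h]
  exact and_congr_right fun hf => ⟨hf.velocityAt_change hx hq, hf.velocityAt_change hq hx⟩

theorem contMDiffAt_phase_iff {f : M → PhaseSpace m Q} {x : M} :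
    ContMDiffAt I (modelPhase m) ∞ f x ↔ ContMDiffAt I (modelQ m) ∞ (fun y => (f y).proj) x ∧
      ContMDiffAt I 𝓘(ℝ, Euc m →L[ℝ] ℝ) ∞ (fun y => momentumAt (f x).proj (f y)) x := by
  refine Bundle.contMDiffAt_totalSpace.trans (and_congr_right fun hf => ?_)
  refine Filter.EventuallyEq.contMDiffAt_iff ?_
  filter_upwards [hf.continuousAt.eventually_mem
    ((chartAt (ℝ × Euc m) (f x).proj).open_source.mem_nhds (mem_chart_source _ _))] with y hy
  rw [hom_trivializationAt_apply]
  ext v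
  simp only [ContinuousLinearMap.inCoordinates, momentumAt, momentum]
  rw [(verticalCore m Q).trivializationAt_symmL hy]
  simp
  rfl

omit [TimeFibred m Q] in
theorem contMDiffAt_cotangent_iff {f : M → CotangentBundle m Q} {x : M} :
    ContMDiffAt I (modelCotangent m) ∞ f x ↔
      ContMDiffAt I (modelQ m) ∞ (fun y => (f y).proj) x ∧
      ContMDiffAt I 𝓘(ℝ, (ℝ × Euc m) →L[ℝ] ℝ) ∞ (fun y => (covector (f y)).comp
        (jac m Q (achart _ (f x).proj) (achart _ (f y).proj) (f y).proj)) x := by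
  refine Bundle.contMDiffAt_totalSpace.trans (and_congr_right fun hf => ?_)
  refine Filter.EventuallyEq.contMDiffAt_iff ?_
  filter_upwards [hf.continuousAt.eventually_mem
    ((chartAt (ℝ × Euc m) (f x).proj).open_source.mem_nhds (mem_chart_source _ _))] with y hy
  rw [hom_trivializationAt_apply]
  refine ContinuousLinearMap.ext fun v => ?_
  simp only [ContinuousLinearMap.inCoordinates, covector]
  rw [TangentBundle.symmL_trivializationAt_eq_core hy]
  simp
  rfl

theorem contMDiff_mkJet (q : Q) : ContMDiff 𝓘(ℝ, Euc m) (modelJet m) ∞ (mkJet (m := m) q) := by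
  intro w
  refine (contMDiffAt_jet_iff (q := q) (mem_chart_source _ q)).2 ⟨contMDiffAt_const, ?_⟩
  exact contMDiffAt_id.congr_of_eventuallyEq
    (Filter.Eventually.of_forall fun w => velocityAt_proj (mkJet q w))

theorem contMDiff_mkPhase (q : Q) :
    ContMDiff 𝓘(ℝ, Euc m →L[ℝ] ℝ) (modelPhase m) ∞ (mkPhase (m := m) q) := by
  intro p
  refine contMDiffAt_phase_iff.2 ⟨contMDiffAt_const, ?_⟩
  exact contMDiffAt_id.congr_of_eventuallyEq
    (Filter.Eventually.of_forall fun p => momentumAt_proj (mkPhase q p))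

/-- The restriction to a fibre over `Q` of a smooth map `V*Q → J¹Q` over `Q` is smooth. -/
theorem ContMDiffAt.contDiffAt_velocity {v : PhaseSpace m Q → JetBundle m Q}
    (hproj : ∀ z, (v z).proj = z.proj) {q : Q} {p : Euc m →L[ℝ] ℝ}
    (hv : ContMDiffAt (modelPhase m) (modelJet m) ∞ v (mkPhase q p)) :
    ContDiffAt ℝ ∞ (fun p => velocity (v (mkPhase q p))) p := by
  have h := ((contMDiffAt_jet_iff (q := q)
    (by rw [Function.comp_apply, hproj]; exact mem_chart_source _ q)).1
    (hv.comp p (contMDiff_mkPhase q p))).2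
  refine contMDiffAt_iff_contDiffAt.1 (h.congr_of_eventuallyEq
    (Filter.Eventually.of_forall fun p => ?_))
  have h1 := velocityAt_proj (v (mkPhase q p))
  rw [hproj] at h1
  exact h1.symm

variable (m Q) in
theorem phaseSpace_sigmaCompact [SecondCountableTopology Q] :
    SigmaCompactSpace (PhaseSpace m Q) := by
  have : SecondCountableTopology (PhaseSpace m Q) :=
    FiberBundle.secondCountableTopology_totalSpace (H := ℝ × Euc m)
  have : LocallyCompactSpace (PhaseSpace m Q) :=
    Manifold.locallyCompact_of_finiteDimensional (modelPhase m)
  infer_instance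

end Coordinates

/-! ### Sections of the Legendre map -/

section ConstraintSpace

variable {m : ℕ} {Q : Type u} [TopologicalSpace Q] [ChartedSpace (ℝ × Euc m) Q]
  [IsManifold (modelQ m) ∞ Q] [TimeFibred m Q] {L : JetBundle m Q → ℝ}

theorem legendreMap_mkJet (L : JetBundle m Q → ℝ) (q : Q) (w : Euc m) :
    legendreMap L (mkJet q w) = mkPhase q (fderiv ℝ (fun w => L (mkJet q w)) w) :=
  rfl

theorem mkPhase_injective (q : Q) : Function.Injective (mkPhase (m := m) q) := by
  intro p p' h
  exact congrArg momentum h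

theorem mkJet_velocity {v : JetBundle m Q} {q : Q} (h : v.proj = q) : mkJet q (velocity v) = v := by
  subst h
  rfl

theorem contDiff_lagrangian_fibre (hL : ContMDiff (modelJet m) 𝓘(ℝ, ℝ) ∞ L) (q : Q) :
    ContDiff ℝ ∞ fun w => L (mkJet q w) :=
  contMDiff_iff_contDiff.1 (hL.comp (contMDiff_mkJet q))

variable {k : ℕ} [ChartedSpace (Euc k) (constraintSpace L)]

/-- Through every jet there is a local section of the Legendre map, extended from `N_L` to an open
subset of `V*Q` as a smooth map to `J¹Q` over `Q`. -/
theorem IsAlmostRegular.exists_local_lift (hreg : IsAlmostRegular L k) (v₀ : JetBundle m Q) :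
    ∃ (U : Set (PhaseSpace m Q)) (v : PhaseSpace m Q → JetBundle m Q), IsOpen U ∧
      legendreMap L v₀ ∈ U ∧ (∀ z, (v z).proj = z.proj) ∧
      ContMDiffOn (modelPhase m) (modelJet m) ∞ v U ∧ v (legendreMap L v₀) = v₀ ∧
      ∀ z ∈ U, z ∈ constraintSpace L → legendreMap L (v z) = z := by
  obtain ⟨O, s, hO, hvO, hs, hsv, hsec⟩ :=
    (hreg.isSubmersion.isSubmersionAt v₀).exists_local_section
  obtain ⟨O', r, hO', hvO', hr, hrι⟩ :=
    hreg.isSmoothEmbedding.exists_local_retraction (legendreMapOnto L v₀)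
  let q := v₀.proj
  -- `s ∘ r` need not cover the identity of `Q` off `N_L`, so only its jet coordinates are kept.
  let v : PhaseSpace m Q → JetBundle m Q := fun z => jetOfCoord q z.proj (velocityAt q (s (r z)))
  have hv : ∀ z : constraintSpace L, z.1 ∈ O' → z ∈ O →
      z.1.proj ∈ (chartAt (ℝ × Euc m) q).source → v z.1 = s z := by
    intro z hz hzO hzq
    have h1 : legendreMap L (s z) = z.1 := congrArg Subtype.val (hsec z hzO)
    have h2 : (s z).proj = z.1.proj := by rw [← h1]; rfl
    simp only [v]
    rw [hrι z hz, ← h2]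
    rw [← h2] at hzq
    exact jetOfCoord_velocityAt hzq
  have hU₁ : IsOpen (O' ∩ r ⁻¹' O) := hr.continuousOn.isOpen_inter_preimage hO' hO
  have hsr : ContMDiffOn (modelPhase m) (modelJet m) ∞ (fun z => s (r z)) (O' ∩ r ⁻¹' O) :=
    hs.comp (hr.mono inter_subset_left) fun z hz => hz.2
  have hproj : ContMDiff (modelJet m) (modelQ m) ∞ (fun v : JetBundle m Q => v.proj) :=
    Bundle.contMDiff_proj _
  have hproj' : ContMDiff (modelPhase m) (modelQ m) ∞ (fun v : PhaseSpace m Q => v.proj) :=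
    Bundle.contMDiff_proj _
  have hU₂ : IsOpen ((O' ∩ r ⁻¹' O) ∩
      (fun z => (s (r z)).proj) ⁻¹' (chartAt (ℝ × Euc m) q).source) :=
    (hproj.comp_contMDiffOn hsr).continuousOn.isOpen_inter_preimage hU₁
      (chartAt (ℝ × Euc m) q).open_source
  have hmem : r (legendreMap L v₀) = legendreMapOnto L v₀ := hrι _ hvO'
  refine ⟨((O' ∩ r ⁻¹' O) ∩ (fun z => (s (r z)).proj) ⁻¹' (chartAt (ℝ × Euc m) q).source) ∩
    (fun z => z.proj) ⁻¹' (chartAt (ℝ × Euc m) q).source, v,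
    hU₂.inter ((chartAt (ℝ × Euc m) q).open_source.preimage hproj'.continuous),
    ⟨⟨⟨hvO', ?_⟩, ?_⟩, mem_chart_source (ℝ × Euc m) q⟩, fun _ => rfl, ?_, ?_, ?_⟩
  · rw [mem_preimage, hmem]
    exact hvO
  · rw [mem_preimage, hmem, hsv]
    exact mem_chart_source (ℝ × Euc m) q
  · rintro z ⟨⟨hz, hzs⟩, hzq⟩
    have h1 := (contMDiffAt_jet_iff (f := fun z => s (r z)) hzs).1
      (hsr.contMDiffAt (hU₁.mem_nhds hz))
    refine ((contMDiffAt_jet_iff (q := q) hzq).2 ⟨hproj' z, ?_⟩).contMDiffWithinAt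
    refine h1.2.congr_of_eventuallyEq ?_
    filter_upwards [((chartAt (ℝ × Euc m) q).open_source.preimage hproj'.continuous).mem_nhds hzq]
      with y hy
    exact velocityAt_jetOfCoord hy _
  · exact (hv (legendreMapOnto L v₀) hvO' hvO (mem_chart_source (ℝ × Euc m) q)).trans hsv
  · rintro z ⟨⟨⟨hz, hzO⟩, -⟩, hzq⟩ hzN
    have hrz : r z = ⟨z, hzN⟩ := hrι ⟨z, hzN⟩ hz
    have hzO' : (⟨z, hzN⟩ : constraintSpace L) ∈ O := hrz ▸ hzO
    rw [hv ⟨z, hzN⟩ hz hzO' hzq]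
    exact congrArg Subtype.val (hsec _ hzO')

/-- The fibres of the Legendre map of an almost regular Lagrangian are convex in jet coordinates:
over a point of `Q` the Legendre map is a gradient map, with local lifts. -/
theorem IsAlmostRegular.convex_fibre (hL : ContMDiff (modelJet m) 𝓘(ℝ, ℝ) ∞ L)
    (hreg : IsAlmostRegular L k) {z : PhaseSpace m Q} (hz : z ∈ constraintSpace L) :
    Convex ℝ {w : Euc m | legendreMap L (mkJet z.proj w) = z} := by
  have heq : {w : Euc m | legendreMap L (mkJet z.proj w) = z}
      = fderiv ℝ (fun w => L (mkJet z.proj w)) ⁻¹' {momentum z} := by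
    ext w
    exact ⟨fun h => congrArg momentum h, fun h => congrArg (mkPhase z.proj) h⟩
  have hconn : IsPreconnected {w : Euc m | legendreMap L (mkJet z.proj w) = z} := by
    have himage : {w : Euc m | legendreMap L (mkJet z.proj w) = z}
        = velocityAt z.proj '' (legendreMapOnto L ⁻¹' {⟨z, hz⟩}) := by
      ext w
      constructor
      · intro h
        exact ⟨mkJet z.proj w, Subtype.ext h, velocityAt_proj (mkJet z.proj w)⟩
      · rintro ⟨v, hv, rfl⟩
        have h1 : legendreMap L v = z := congrArg Subtype.val hv
        have h2 : v.proj = z.proj := congrArg TotalSpace.proj h1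
        rw [mem_ofPred_eq, ← h2, velocityAt_proj]
        exact h1
    rw [himage]
    refine (hreg.isConnected_fibre _).isPreconnected.image _ fun v hv => ?_
    have h1 : legendreMap L v = z := congrArg Subtype.val hv
    have h2 : v.proj = z.proj := congrArg TotalSpace.proj h1
    exact ((contMDiffAt_jet_iff (q := z.proj) (f := id)
      (by rw [id, h2]; exact mem_chart_source _ _)).1
      (contMDiffAt_id (I := modelJet m))).2.continuousAt.continuousWithinAt
  rw [heq] at hconn ⊢
  refine convex_fibre_fderiv (contDiff_lagrangian_fibre hL z.proj) (fun w => ?_) _ hconn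
  obtain ⟨U, v, hU, hwU, hproj, hv, hvw, hsec⟩ := hreg.exists_local_lift (mkJet z.proj w)
  refine ⟨fun p => velocity (v (mkPhase z.proj p)), ⟨?_, ?_, ?_⟩⟩
  · exact (ContMDiffAt.contDiffAt_velocity hproj (hv.contMDiffAt (hU.mem_nhds hwU))).of_le (by simp)
  · exact congrArg velocity hvw
  · filter_upwards [((contMDiff_mkPhase (m := m) z.proj).continuous.isOpen_preimage _ hU).mem_nhds
      hwU] with p hp
    rintro ⟨w', rfl⟩
    have h := hsec _ hp ⟨mkJet z.proj w', rfl⟩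
    rw [← mkJet_velocity (hproj _), legendreMap_mkJet] at h
    exact mkPhase_injective _ h

/-- The Legendre map of an almost regular Lagrangian has a global section, which moreover extends
to a smooth map `V*Q → J¹Q` over `Q`: local sections are glued by a partition of unity. -/
theorem IsAlmostRegular.exists_global_lift [T2Space Q] [SecondCountableTopology Q]
    (hL : ContMDiff (modelJet m) 𝓘(ℝ, ℝ) ∞ L) {k : ℕ} [ChartedSpace (Euc k) (constraintSpace L)]
    (hreg : IsAlmostRegular L k) :
    ∃ V : PhaseSpace m Q → JetBundle m Q, ContMDiff (modelPhase m) (modelJet m) ∞ V ∧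
      (∀ z, (V z).proj = z.proj) ∧ ∀ z ∈ constraintSpace L, legendreMap L (V z) = z := by
  have : T2Space (PhaseSpace m Q) := FiberBundle.t2Space_totalSpace
  have : SigmaCompactSpace (PhaseSpace m Q) := phaseSpace_sigmaCompact m Q
  have hloc : ∀ z₀ : PhaseSpace m Q, ∃ (U : Set (PhaseSpace m Q))
      (v : PhaseSpace m Q → JetBundle m Q), IsOpen U ∧ z₀ ∈ U ∧ (∀ z, (v z).proj = z.proj) ∧
      ContMDiffOn (modelPhase m) (modelJet m) ∞ v U ∧
      ∀ z ∈ U, z ∈ constraintSpace L → legendreMap L (v z) = z := by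
    intro z₀
    -- Off the closed set `N_L` the section condition is void, and any local map over `Q` will do.
    by_cases hz₀ : z₀ ∈ constraintSpace L
    · obtain ⟨v₀, rfl⟩ := hz₀
      obtain ⟨U, v, hU, hvU, hproj, hv, -, hsec⟩ := hreg.exists_local_lift v₀
      exact ⟨U, v, hU, hvU, hproj, hv, hsec⟩
    · have hproj : ContMDiff (modelPhase m) (modelQ m) ∞ (fun v : PhaseSpace m Q => v.proj) :=
        Bundle.contMDiff_proj _
      have hO : IsOpen ((fun z : PhaseSpace m Q => z.proj) ⁻¹'
          (chartAt (ℝ × Euc m) z₀.proj).source) :=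
        (chartAt (ℝ × Euc m) z₀.proj).open_source.preimage hproj.continuous
      refine ⟨(fun z => z.proj) ⁻¹' (chartAt (ℝ × Euc m) z₀.proj).source ∩ (constraintSpace L)ᶜ,
        fun z => jetOfCoord z₀.proj z.proj 0, hO.inter hreg.isClosed.isOpen_compl,
        ⟨mem_chart_source _ _, hz₀⟩, fun _ => rfl, ?_, fun z hz hzN => absurd hzN hz.2⟩
      rintro z ⟨hz, -⟩
      refine ((contMDiffAt_jet_iff (q := z₀.proj) hz).2 ⟨hproj z, ?_⟩).contMDiffWithinAt
      refine (contMDiffAt_const (c := (0 : Euc m))).congr_of_eventuallyEq ?_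
      filter_upwards [hO.mem_nhds hz] with y hy
      exact velocityAt_jetOfCoord hy _
  choose U v hU hmem hproj hv hsec using hloc
  obtain ⟨ρ, hρ⟩ := SmoothPartitionOfUnity.exists_isSubordinate (modelPhase m) isClosed_univ U hU
    fun z _ => mem_iUnion_of_mem z (hmem z)
  refine ⟨fun z => mkJet z.proj (∑ᶠ c, ρ c z • velocity (v c z)), fun z₁ => ?_, fun _ => rfl,
    fun z hz => ?_⟩
  · have hprojQ : ContMDiff (modelPhase m) (modelQ m) ∞ (fun v : PhaseSpace m Q => v.proj) :=
      Bundle.contMDiff_proj _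
    refine (contMDiffAt_jet_iff (q := z₁.proj) (mem_chart_source _ _)).2 ⟨hprojQ z₁, ?_⟩
    have hsmooth : ContMDiffAt (modelPhase m) 𝓘(ℝ, Euc m) ∞
        (fun z => ∑ᶠ c, ρ c z • velocityAt z₁.proj (v c z)) z₁ := by
      refine ρ.contMDiffAt_finsum fun c hc => ?_
      exact ((contMDiffAt_jet_iff (q := z₁.proj)
        (by rw [hproj]; exact mem_chart_source _ _)).1
        ((hv c).contMDiffAt ((hU c).mem_nhds (hρ c hc)))).2
    refine hsmooth.congr_of_eventuallyEq (Filter.Eventually.of_forall fun z => ?_)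
    simp only
    rw [← ρ.sum_finsupport_smul_eq_finsum z (fun c z => velocity (v c z)),
      ← ρ.sum_finsupport_smul_eq_finsum z (fun c z => velocityAt z₁.proj (v c z)),
      velocityAt_mkJet_sum _ _ _ _ _ (ρ.sum_finsupport z (mem_univ z))]
    exact Finset.sum_congr rfl fun c _ => by rw [mkJet_velocity (hproj c z)]
  · refine (hreg.convex_fibre hL hz).finsum_mem (fun c => ρ.nonneg c z)
      (ρ.sum_eq_one (mem_univ z)) fun c hc => ?_
    have hcz : z ∈ U c := hρ c (subset_closure hc)
    rw [mem_ofPred_eq, mkJet_velocity (hproj c z)]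
    exact hsec c z hcz hz

end ConstraintSpace

/-! ### The Hamiltonian form of a section -/

section HamiltonianForms

variable {m : ℕ} {Q : Type u} [TopologicalSpace Q] [ChartedSpace (ℝ × Euc m) Q]
  [IsManifold (modelQ m) ∞ Q] [TimeFibred m Q] {L : JetBundle m Q → ℝ}

/-- The Hamiltonian form of a smooth map `V : V*Q → J¹Q` over `Q`: its value at `z` is the covector
which restricts to `z` on vertical vectors and takes the value `𝓛(V(z))` on the tangent vector
`(1, V(z))`. Its Hamiltonian is `𝓗 = pᵢ Vⁱ - 𝓛(V)`. -/
def hamiltonianFormOf (hL : ContMDiff (modelJet m) 𝓘(ℝ, ℝ) ∞ L)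
    (V : PhaseSpace m Q → JetBundle m Q) (hV : ContMDiff (modelPhase m) (modelJet m) ∞ V)
    (hproj : ∀ z, (V z).proj = z.proj) : HamiltonianForm m Q where
  toFun z := mkCovector z.proj ((momentum z).comp (ContinuousLinearMap.snd ℝ ℝ (Euc m) -
    (ContinuousLinearMap.fst ℝ ℝ (Euc m)).smulRight (velocity (V z))) +
    L (V z) • ContinuousLinearMap.fst ℝ ℝ (Euc m))
  contMDiff_toFun := by
    intro z₁
    have hprojQ : ContMDiff (modelPhase m) (modelQ m) ∞ (fun v : PhaseSpace m Q => v.proj) :=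
      Bundle.contMDiff_proj _
    refine contMDiffAt_cotangent_iff.2 ⟨hprojQ z₁, ?_⟩
    have hp := (contMDiffAt_phase_iff (f := fun z : PhaseSpace m Q => z)).1
      (contMDiffAt_id (I := modelPhase m) (x := z₁))
    have hw := (contMDiffAt_jet_iff (q := z₁.proj)
      (by rw [hproj]; exact mem_chart_source _ _)).1 (hV z₁)
    have hw' : ContMDiffAt (modelPhase m) 𝓘(ℝ, (ℝ × Euc m) →L[ℝ] Euc m) ∞
        (fun z => (ContinuousLinearMap.fst ℝ ℝ (Euc m)).smulRight (velocityAt z₁.proj (V z))) z₁ :=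
      (ContinuousLinearMap.smulRightL ℝ (ℝ × Euc m) (Euc m)
        (ContinuousLinearMap.fst ℝ ℝ (Euc m))).contMDiff.contMDiffAt.comp z₁ hw.2
    have hsmooth : ContMDiffAt (modelPhase m) 𝓘(ℝ, (ℝ × Euc m) →L[ℝ] ℝ) ∞
        (fun z => (momentumAt z₁.proj z).comp (ContinuousLinearMap.snd ℝ ℝ (Euc m) -
          (ContinuousLinearMap.fst ℝ ℝ (Euc m)).smulRight (velocityAt z₁.proj (V z))) +
          L (V z) • ContinuousLinearMap.fst ℝ ℝ (Euc m)) z₁ :=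
      (hp.2.clm_comp (contMDiffAt_const.sub hw')).add
        (((hL.comp hV) z₁).smul contMDiffAt_const)
    refine hsmooth.congr_of_eventuallyEq ?_
    filter_upwards [hprojQ.continuous.continuousAt.eventually_mem
      ((chartAt (ℝ × Euc m) z₁.proj).open_source.mem_nhds (mem_chart_source _ z₁.proj))] with z hz
    refine ContinuousLinearMap.ext fun ξ => ?_
    have hzz := mem_chart_source (ℝ × Euc m) z.proj
    have hfst : (jac m Q (achart _ z₁.proj) (achart _ z.proj) z.proj ξ).1 = ξ.1 :=
      jac_fst (achart _ z₁.proj) (achart _ z.proj) z.proj hz hzz ξ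
    -- The tangent vector `(1, V(z))` does not depend on the chart, and `ξ - ξ.1 • (1, V(z))` is
    -- vertical: hence the formula for the covector has the same shape in every chart.
    have hvel : jac m Q (achart _ z₁.proj) (achart _ z.proj) z.proj
        (1, velocityAt z₁.proj (V z)) = (1, velocity (V z)) := by
      have h := one_velocityAt (q := z₁.proj) (v := V z) (by rw [hproj]; exact hz)
      rw [hproj] at h
      rw [h, jac_jac _ _ _ hzz hz hzz, jac_self _ hzz]
    have hkey : jac m Q (achart _ z₁.proj) (achart _ z.proj) z.proj
        (0, ξ.2 - ξ.1 • velocityAt z₁.proj (V z))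
        = jac m Q (achart _ z₁.proj) (achart _ z.proj) z.proj ξ - ξ.1 • (1, velocity (V z)) := by
      rw [← hvel, ← map_smul, ← map_sub]
      congr 1
      ext1 <;> simp
    change momentum z ((jac m Q (achart _ z₁.proj) (achart _ z.proj) z.proj ξ).2 -
      (jac m Q (achart _ z₁.proj) (achart _ z.proj) z.proj ξ).1 • velocity (V z)) +
      L (V z) * (jac m Q (achart _ z₁.proj) (achart _ z.proj) z.proj ξ).1 =
      momentum z (jac m Q (achart _ z₁.proj) (achart _ z.proj) z.proj
        (0, ξ.2 - ξ.1 • velocityAt z₁.proj (V z))).2 + L (V z) * ξ.1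
    rw [hkey, hfst]
    rfl
  toPhaseSpace_toFun z := by
    have h : ((momentum z).comp (ContinuousLinearMap.snd ℝ ℝ (Euc m) -
        (ContinuousLinearMap.fst ℝ ℝ (Euc m)).smulRight (velocity (V z))) +
        L (V z) • ContinuousLinearMap.fst ℝ ℝ (Euc m)).comp (ContinuousLinearMap.inr ℝ ℝ (Euc m))
        = momentum z := by
      ext w
      simp
    exact congrArg (mkPhase z.proj) h

variable (hL : ContMDiff (modelJet m) 𝓘(ℝ, ℝ) ∞ L) {V : PhaseSpace m Q → JetBundle m Q}
  (hV : ContMDiff (modelPhase m) (modelJet m) ∞ V) (hproj : ∀ z, (V z).proj = z.proj)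

theorem hamiltonian_hamiltonianFormOf (z : PhaseSpace m Q) :
    (hamiltonianFormOf hL V hV hproj).hamiltonian z
      = momentum z (velocity (V z)) - L (V z) := by
  have h : (hamiltonianFormOf hL V hV hproj).hamiltonian z
      = -(momentum z (0 - (1 : ℝ) • velocity (V z)) + L (V z) * 1) := rfl
  rw [h]
  simp only [one_smul, zero_sub, map_neg]
  ring

/-- Where `V` inverts the Legendre map, it is the Hamiltonian map of its Hamiltonian form: in
`∂𝓗/∂pᵢ = Vⁱ + (pⱼ - (∂𝓛/∂qʲ_t)(V)) ∂Vʲ/∂pᵢ` the second term vanishes. -/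
theorem hamiltonianMap_hamiltonianFormOf {z : PhaseSpace m Q} (hz : legendreMap L (V z) = z) :
    (hamiltonianFormOf hL V hV hproj).hamiltonianMap z = V z := by
  set q := z.proj with hq
  let f : Euc m → ℝ := fun w => L (mkJet q w)
  let w : (Euc m →L[ℝ] ℝ) → Euc m := fun p => velocity (V (mkPhase q p))
  have hw : HasFDerivAt w (fderiv ℝ w (momentum z)) (momentum z) :=
    ((ContMDiffAt.contDiffAt_velocity hproj (hV (mkPhase q (momentum z)))).differentiableAt
      (by simp)).hasFDerivAt
  have hf : HasFDerivAt f (fderiv ℝ f (w (momentum z))) (w (momentum z)) :=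
    ((contDiff_lagrangian_fibre hL q).differentiable (by simp) _).hasFDerivAt
  have hgrad : fderiv ℝ f (w (momentum z)) = momentum z := by
    rw [← mkJet_velocity (hproj z)] at hz
    exact congrArg momentum hz
  rw [hgrad] at hf
  have hham : (fun p => (hamiltonianFormOf hL V hV hproj).hamiltonian (mkPhase q p))
      = fun p => p (w p) - f (w p) := by
    funext p
    rw [hamiltonian_hamiltonianFormOf]
    change _ = p (w p) - L (mkJet q (velocity (V (mkPhase q p))))
    rw [mkJet_velocity (q := q) (hproj (mkPhase q p))]
    rfl
  have hder := ((hasFDerivAt_id (momentum z)).clm_apply hw).sub (hf.comp (momentum z) hw)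
  have hfd : ∀ δ, fderiv ℝ (fun p => (hamiltonianFormOf hL V hV hproj).hamiltonian (mkPhase q p))
      (momentum z) δ = δ (velocity (V z)) := by
    intro δ
    rw [hham, HasFDerivAt.fderiv (f := fun p => p (w p) - f (w p)) hder]
    simp
    rfl
  refine Eq.trans ?_ (mkJet_velocity (hproj z))
  -- The derivative in the direction of `dqⁱ` is the `i`-th component.
  refine congrArg (mkJet q) (PiLp.ext fun i => ?_)
  exact hfd (EuclideanSpace.proj i)

end HamiltonianForms

end

theorem theorem3p5 {m : ℕ} {Q : Type u} [TopologicalSpace Q] [T2Space Q]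
    [SecondCountableTopology Q] [ChartedSpace (ℝ × Euc m) Q] [IsManifold (modelQ m) ∞ Q]
    [TimeFibred m Q]
    (hQ : IsSmoothFibreBundle (modelQ m) 𝓘(ℝ, ℝ) (TimeFibred.time m : Q → ℝ))
    (L : JetBundle m Q → ℝ) (hL : ContMDiff (modelJet m) 𝓘(ℝ, ℝ) ∞ L)
    {k : ℕ} [ChartedSpace (Euc k) (constraintSpace L)]
    [IsManifold 𝓘(ℝ, Euc k) ∞ (constraintSpace L)] (hreg : IsAlmostRegular L k) :
    ((∃ H : HamiltonianForm m Q, IsWeaklyAssociated H L) ↔ HasGlobalSection L k) ∧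
    ((∃ H : HamiltonianForm m Q, IsWeaklyAssociated H L ∧ IsProjecting H L) ↔
      HasGlobalSection L k) := by
  obtain ⟨V, hV, hproj, hsec⟩ := hreg.exists_global_lift hL
  have hsection : HasGlobalSection L k :=
    ⟨fun z => V z.1, hV.comp hreg.isSmoothEmbedding.contMDiff,
      fun z => Subtype.ext (hsec z.1 z.2)⟩
  let H := hamiltonianFormOf hL V hV hproj
  have hmap : ∀ z ∈ constraintSpace L, H.hamiltonianMap z = V z := fun z hz =>
    hamiltonianMap_hamiltonianFormOf hL hV hproj (hsec z hz)
  have hweak : IsWeaklyAssociated H L := by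
    intro z hz
    rw [hmap z hz, HamiltonianForm.lagrangian, hamiltonian_hamiltonianFormOf, sub_sub_cancel]
  have hpr : IsProjecting H L := by
    funext v
    have hv : legendreMap L v ∈ constraintSpace L := mem_range_self v
    rw [Function.comp_apply, Function.comp_apply, hmap _ hv, hsec _ hv]
  exact ⟨⟨fun _ => hsection, fun _ => ⟨H, hweak⟩⟩, ⟨fun _ => hsection, fun _ => ⟨H, hweak, hpr⟩⟩⟩
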